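/- All graphs are finite and simple, and $\mathrm{Aut}(G)$ is the automorphism group of a graph $G$. A vertex colouring $c$ of $G$ is distinguishing if the identity is the only $\sigma\in\mathrm{Aut}(G)$ with $c\circ\sigma=c$. In the distinguishing game on $G$ with $d\ge 1$ colours, two players, Gentle and Rascal, alternately choose an uncoloured vertex of $G$ and give it one of the $d$ colours, until all vertices are coloured; Gentle wins if the resulting colouring is distinguishing, and Rascal wins otherwise. Let $D_{\mathcal G}(G)$ (respectively $D_{\mathcal R}(G)$) be the least $d\ge 1$ for which Gentle has a winning strategy when Gentle (respectively Rascal) makes the first move, and $\infty$ if there is no such $d$. The cartesian product $H\square F$ has vertex set $V(H)\times V(F)$, with $(u,v)$ adjacent to $(u',v')$ if and only if $u=u'$ and $vv'\in E(F)$, or $v=v'$ and $uu'\in E(H)$. Two nonempty graphs $H$ and $F$ are relatively prime if there is no graph $K$ with at least two vertices such that $H\cong K\square H'$ and $F\cong K\square F'$ for some graphs $H'$ and $F'$. **Theorem.** Let $H$ and $F$ be connected, relatively prime graphs, each with at least two vertices, of respective orders $n$ and $m$. 1. If $n$ is even and $m\ge n-1$, then $D_{\mathcal R}(H\square F)\le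 m+1$. 2. If $n$ is odd, $m$ is even and $m\ge 2n-2$, then $D_{\mathcal R}(H\square F)\le m+1$. 3. If $n$ and $m$ are odd and $m\ge 2n-1$, then $D_{\mathcal G}(H\square F)\le m+1$. -/

import Mathlib

namespace DistinguishingGame

universe u v

/-- A vertex colouring `c` of `G` is distinguishing if the identity is the only automorphism of `G`
which preserves it. -/
def IsDistinguishing {V : Type u} {C : Type v} (G : SimpleGraph V) (c : V → C) : Prop :=
  ∀ σ : G ≃g G, (∀ x, c (σ x) = c x) → ∀ x, σ x = x

/-- The two players of the distinguishing game. -/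
inductive Player : Type
  | gentle
  | rascal

/-- A history of the game with vertex set `V` and the `d` colours `Fin d`: the list of the moves
made so far, the latest one first. The move `(x, c)` colours the vertex `x` with the colour `c`. -/
abbrev History (V : Type u) (d : ℕ) : Type u := List (V × Fin d)

/-- The vertex `x` has not been coloured yet. -/
def Uncolored {V : Type u} {d : ℕ} (h : History V d) (x : V) : Prop :=
  ∀ c : Fin d, (x, c) ∉ h

/-- A strategy of Gentle prescribes his next move, as a function of the history.
(The value `none` prescribes no move.) -/
abbrev Strategy (V : Type u) (d : ℕ) : Type u := History V d → Option (V × Fin d)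

/-- `Play s first p h` : the history `h` can occur in a game opened by `first` in which Gentle
follows the strategy `s` and Rascal makes arbitrary legal moves, and `p` is to move next.
A move is legal if it colours a vertex that was uncoloured. -/
inductive Play {V : Type u} {d : ℕ} (s : Strategy V d) (first : Player) :
    Player → History V d → Prop
  | start : Play s first first []
  | gentle_move {h : History V d} {x : V} {c : Fin d} :
      Play s first Player.gentle h → Uncolored h x → s h = some (x, c) →
      Play s first Player.rascal ((x, c) :: h)
  | rascal_move {h : History V d} {x : V} {c : Fin d} :
      Play s first Player.rascal h → Uncolored h x →
      Play s first Player.gentle ((x, c) :: h)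

/-- The strategy `s` is winning for Gentle in the game on the finite graph `G` opened by `first`:
as long as some vertex is uncoloured, it prescribes a legal move whenever Gentle is to move, and
every colouring of all the vertices in which the game can end is distinguishing. -/
structure IsWinning {V : Type u} {d : ℕ} (G : SimpleGraph V) (first : Player)
    (s : Strategy V d) : Prop where
  legal : ∀ h : History V d, Play s first Player.gentle h → (∃ x, Uncolored h x) →
    ∃ x c, s h = some (x, c) ∧ Uncolored h x
  wins : ∀ (p : Player) (h : History V d), Play s first p h →
    ∀ c : V → Fin d, (∀ x, (x, c x) ∈ h) → IsDistinguishing G c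

/-- Gentle has a winning strategy in the game on `G` with `d` colours opened by `first`. -/
def GentleHasWinningStrategy {V : Type u} (G : SimpleGraph V) (d : ℕ) (first : Player) : Prop :=
  ∃ s : Strategy V d, IsWinning G first s

/-- The game distinguishing number of the finite graph `G` when `first` starts: the least number
`d ≥ 1` of colours for which Gentle has a winning strategy, and `⊤` if there is no such `d`. -/
noncomputable def gameDistinguishingNumber {V : Type u} (G : SimpleGraph V) (first : Player) : ℕ∞ :=
  ⨅ d ∈ {d : ℕ | 1 ≤ d ∧ GentleHasWinningStrategy G d first}, (d : ℕ∞)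

/-- The `G`-game distinguishing number `D_𝒢`: Gentle starts. -/
noncomputable def DG {V : Type u} (G : SimpleGraph V) : ℕ∞ :=
  gameDistinguishingNumber G Player.gentle

/-- The `R`-game distinguishing number `D_ℛ`: Rascal starts. -/
noncomputable def DR {V : Type u} (G : SimpleGraph V) : ℕ∞ :=
  gameDistinguishingNumber G Player.rascal

/-- `K` is a factor of `G` with respect to the cartesian product of graphs. -/
def IsCartesianFactor {U : Type u} {V : Type v} (K : SimpleGraph U) (G : SimpleGraph V) : Prop :=
  ∃ (X : Type v) (L : SimpleGraph X), Nonempty (G ≃g K.boxProd L)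

/-- Two nonempty graphs are relatively prime if they have no common factor with at least two
vertices, with respect to the cartesian product. (A factor of a nonempty graph has a copy in the
universe of that graph, so restricting the universe of `U` loses nothing.) -/
def RelativelyPrime {V : Type u} {W : Type v} (H : SimpleGraph V) (F : SimpleGraph W) : Prop :=
  ∀ (U : Type u) (K : SimpleGraph U), IsCartesianFactor K H → IsCartesianFactor K F →
    ¬ Nontrivial U

end DistinguishingGame

/-!
Since `H` and `F` are connected and relatively prime, every automorphism of `H □ F` has the form
`(v, w) ↦ (α v, β w)` (`RelativelyPrime.apply_eq`). The reason is that the layers of a product are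
convex, and a convex set is a box with respect to any product decomposition. Hence, if `σ` is an
automorphism, an `H`-layer is the product of its intersections with the images of an `H`-layer and
of an `F`-layer under `σ`, and the second of these is isomorphic to a factor of both `H` and `F`, so
it is a point (`exists_common_factor`).

Let `m` be the order of `F`, let the colours be the elements of the cyclic group `Fin (m + 1)`, and
consider the `m` rows `V × {w}`. A colouring is distinguishing as soon as

* different rows have different sums of colours, which forces `β` to be the identity, and
* any two columns differ in some row, which then forces `α` to be the identity

(`Good.isDistinguishing`). To get the second property, an involution of `V` is assigned to each row,
in such a way that any two points of `V` are exchanged by one of the involutions in use. Gentle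
answers a move of Rascal at the partner of Rascal's vertex in the same row, with a different colour.
He is then the last to move in the row, and `m + 1` colours are enough to keep the row sums
different at the same time (`Good.answer`).

If the order `n` of `H` is even, the involutions are the `n - 1` matchings of a one-factorization of
the complete graph on `V`. If `n` is odd, they are the `n` reflections of `ZMod n`, each of which
has one fixed point, and the involution of a row is determined by the vertex coloured first in it. If
Rascal is the first to play in a row, Gentle is the first to play in another one, where he selects
an involution not used before (`OddInvariant.answer`). The assumptions on `m` guarantee that all
involutions are used in the end.
-/

namespace DistinguishingGame

universe u v

/-! ### Automorphisms of a product of relatively prime graphs -/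

section Automorphisms

open SimpleGraph

theorem edist_apply_le {α β : Type*} {G : SimpleGraph α} {G' : SimpleGraph β} (σ : G ≃g G')
    (x y : α) : G'.edist (σ x) (σ y) ≤ G.edist x y := by
  by_cases h : G.edist x y = ⊤
  · simp [h]
  · obtain ⟨p, hp⟩ := exists_walk_of_edist_ne_top h
    rw [← hp]
    simpa using edist_le (p.map σ.toHom)

theorem edist_apply {α β : Type*} {G : SimpleGraph α} {G' : SimpleGraph β} (σ : G ≃g G')
    (x y : α) : G'.edist (σ x) (σ y) = G.edist x y :=
  le_antisymm (edist_apply_le σ x y) (by simpa using edist_apply_le σ.symm (σ x) (σ y))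

variable {α β γ δ : Type*} {A : SimpleGraph α} {B : SimpleGraph β} {C : SimpleGraph γ}
  {D : SimpleGraph δ}

/-- A layer of one product decomposition is convex, so it is a box with respect to every other
product decomposition: the point combining the `C`-coordinate of one of its points and the
`D`-coordinate of another one lies on a geodesic between them. -/
theorem exists_mem_layer_eq (hA : A.Connected) (hB : B.Connected) (σ : A.boxProd B ≃g C.boxProd D)
    (a₁ a₂ : α) (b : β) : ∃ a, σ (a, b) = ((σ (a₁, b)).1, (σ (a₂, b)).2) := by
  obtain ⟨⟨a, b'⟩, hz⟩ := σ.surjective ((σ (a₁, b)).1, (σ (a₂, b)).2)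
  have h₁ := edist_apply σ (a₁, b) (a, b')
  have h₂ := edist_apply σ (a, b') (a₂, b)
  have h₃ := edist_apply σ (a₁, b) (a₂, b)
  rw [hz] at h₁ h₂
  simp only [edist_boxProd, edist_self, zero_add, add_zero] at h₁ h₂ h₃
  have h₄ := A.edist_triangle (u := a₁) (v := a) (w := a₂)
  rw [← h₃, h₂, add_comm, h₁] at h₄
  have e₁ := edist_ne_top_iff_reachable.2 (hA a₁ a)
  have e₂ := edist_ne_top_iff_reachable.2 (hA a a₂)
  have e₃ := edist_ne_top_iff_reachable.2 (hB b b')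
  have e₄ := edist_ne_top_iff_reachable.2 (hB b' b)
  -- The detour through `b'` costs `edist b b'` twice, so `b' = b`.
  have hb : B.edist b b' = 0 := by
    lift A.edist a₁ a to ℕ using e₁ with x
    lift A.edist a a₂ to ℕ using e₂ with y
    lift B.edist b b' to ℕ using e₃ with z
    lift B.edist b' b to ℕ using e₄ with t
    norm_cast at h₄ ⊢
    omega
  rw [edist_eq_zero_iff] at hb
  subst hb
  exact ⟨a, hz⟩

/-- A graph embedded in a cartesian product as a box is the product of the two sides of the box
through any of its points. -/
theorem nonempty_iso_boxProd_of_box (ψ : A ↪g C.boxProd D) (a₀ : α)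
    (hψ : ∀ a₁ a₂, ∃ a, ψ a = ((ψ a₁).1, (ψ a₂).2)) :
    Nonempty (A ≃g (A.induce {a | (ψ a).1 = (ψ a₀).1}).boxProd
      (A.induce {a | (ψ a).2 = (ψ a₀).2})) := by
  choose k hk using hψ
  -- `k a₁ a₂` combines the `C`-coordinate of `a₁` and the `D`-coordinate of `a₂`.
  have adj : ∀ x y, A.Adj x y ↔ (C.boxProd D).Adj (ψ x) (ψ y) := fun x y => ψ.map_adj_iff.symm
  refine ⟨⟨⟨fun a => (⟨k a₀ a, by simp [hk]⟩, ⟨k a a₀, by simp [hk]⟩), fun p => k p.2 p.1,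
    fun a => ψ.injective (by simp [hk]), ?_⟩, ?_⟩⟩
  · rintro ⟨⟨s, hs⟩, ⟨t, ht⟩⟩
    simp only [Set.mem_ofPred_eq] at hs ht
    ext
    · exact ψ.injective (by simp [hk, ← hs])
    · exact ψ.injective (by simp [hk, ← ht])
  · intro x y
    have e₁ : k a₀ x = k a₀ y ↔ (ψ x).2 = (ψ y).2 := by
      rw [← ψ.injective.eq_iff]; simp [hk]
    have e₂ : k x a₀ = k y a₀ ↔ (ψ x).1 = (ψ y).1 := by
      rw [← ψ.injective.eq_iff]; simp [hk]
    simp only [Equiv.coe_fn_mk, boxProd_adj, induce_adj, Subtype.mk.injEq, e₁, e₂, adj, hk,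
      SimpleGraph.irrefl, false_and, and_true, or_false, false_or]
    tauto

/-- The cartesian product of an isomorphism with the identity. -/
def boxProdIsoLeft {κ : Type*} {K : SimpleGraph κ} (e : A ≃g C) :
    A.boxProd K ≃g C.boxProd K where
  toEquiv := e.toEquiv.prodCongr (Equiv.refl κ)
  map_rel_iff' := by
    rintro ⟨a, b⟩ ⟨a', b'⟩
    have := e.map_adj_iff (v := a) (w := a')
    simp [this]

/-- Where two product decompositions `A □ B` and `C □ D` of a graph are compared, the common part
of an `A`-layer and a `D`-layer is a factor of `A` and of `D`. -/
theorem exists_common_factor (hA : A.Connected) (hB : B.Connected) (hC : C.Connected)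
    (hD : D.Connected) (σ : A.boxProd B ≃g C.boxProd D) (a₀ : α) (b₀ : β) :
    ∃ T : Set δ,
      Nonempty (A.induce {a | (σ (a, b₀)).1 = (σ (a₀, b₀)).1} ≃g D.induce T) ∧
      IsCartesianFactor (A.induce {a | (σ (a, b₀)).1 = (σ (a₀, b₀)).1}) A ∧
      IsCartesianFactor (D.induce T) D := by
  set c₀ := (σ (a₀, b₀)).1 with hc₀
  set d₀ := (σ (a₀, b₀)).2 with hd₀
  have hcd : σ.symm (c₀, d₀) = (a₀, b₀) := by simp [hc₀, hd₀]
  refine ⟨{d | (σ.symm (c₀, d)).2 = b₀}, ⟨⟨⟨fun a => ⟨(σ (a.1, b₀)).2, ?_⟩,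
    fun d => ⟨(σ.symm (c₀, d.1)).1, ?_⟩, ?_, ?_⟩, ?_⟩⟩, ?_, ?_⟩
  · obtain ⟨a, ha⟩ := a
    simp only [Set.mem_ofPred_eq] at ha ⊢
    rw [← ha]; simp
  · obtain ⟨d, hd⟩ := d
    simp only [Set.mem_ofPred_eq] at hd ⊢
    rw [← hd]; simp
  · rintro ⟨a, ha⟩
    simp only [Set.mem_ofPred_eq] at ha
    simp [← ha]
  · rintro ⟨d, hd⟩
    simp only [Set.mem_ofPred_eq] at hd
    simp [← hd]
  · rintro ⟨a, ha⟩ ⟨a', ha'⟩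
    simp only [Set.mem_ofPred_eq] at ha ha'
    have := σ.map_adj_iff (v := (a, b₀)) (w := (a', b₀))
    simpa [ha, ha'] using this
  · obtain ⟨e⟩ := nonempty_iso_boxProd_of_box
      ((boxProdLeft A B b₀).trans σ.toEmbedding : A ↪g C.boxProd D) a₀
      (fun a₁ a₂ => exists_mem_layer_eq hA hB σ a₁ a₂ b₀)
    exact ⟨_, _, ⟨e⟩⟩
  · obtain ⟨e⟩ := nonempty_iso_boxProd_of_box
      ((boxProdRight C D c₀).trans σ.symm.toEmbedding : D ↪g A.boxProd B) d₀ (fun d₁ d₂ => by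
        obtain ⟨d, hd⟩ := exists_mem_layer_eq hD hC
          ((boxProdComm D C).trans (σ.symm.trans (boxProdComm A B))) d₂ d₁ c₀
        refine ⟨d, ?_⟩
        simpa [Prod.ext_iff, and_comm] using hd)
    have e' := e.trans (boxProdComm _ _)
    have hb : b₀ = (((boxProdRight C D c₀).trans σ.symm.toEmbedding : D ↪g A.boxProd B) d₀).2 := by
      simp [hcd]
    rw [← hb] at e'
    exact ⟨_, _, ⟨e'⟩⟩

/-- If the common part of an `A`-layer and a `D`-layer is a single point, then every `A`-layer is
contained in a `C`-layer. -/
theorem snd_eq_of_subsingleton (hA : A.Connected) (hB : B.Connected)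
    (σ : A.boxProd B ≃g C.boxProd D) (a₀ : α) (b₀ : β)
    (h : {a | (σ (a, b₀)).1 = (σ (a₀, b₀)).1}.Subsingleton) (a : α) :
    (σ (a, b₀)).2 = (σ (a₀, b₀)).2 := by
  obtain ⟨s, hs⟩ := exists_mem_layer_eq hA hB σ a₀ a b₀
  have : s = a₀ := h (by simp [hs]) rfl
  rw [← this, hs]

/-- Automorphisms of the product of two connected relatively prime graphs act on the two
coordinates separately. -/
theorem RelativelyPrime.apply_eq {V : Type u} {W : Type v} {H : SimpleGraph V} {F : SimpleGraph W}
    (hHF : RelativelyPrime H F) (hH : H.Connected) (hF : F.Connected)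
    (σ : H.boxProd F ≃g H.boxProd F) (v v' : V) (w w' : W) :
    σ (v, w) = ((σ (v, w')).1, (σ (v', w)).2) := by
  refine Prod.ext ?_ ?_
  · -- With the two factors exchanged, the common factor found is a graph on a subset of `W`;
    -- its copy `T` in `V` has the universe level that `RelativelyPrime` asks for.
    let τ : F.boxProd H ≃g F.boxProd H := (boxProdComm F H).trans (σ.trans (boxProdComm H F))
    obtain ⟨T, ⟨e⟩, ⟨X, L, ⟨f⟩⟩, hT⟩ := exists_common_factor hF hH hF hH τ w' v
    have hn := hHF _ _ hT ⟨X, L, ⟨f.trans (boxProdIsoLeft e)⟩⟩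
    refine snd_eq_of_subsingleton hF hH τ w' v ?_ w
    rw [← Set.not_nontrivial_iff, ← Set.nontrivial_coe_sort]
    exact fun h => hn e.symm.toEquiv.nontrivial
  · obtain ⟨T, ⟨e⟩, hS, ⟨X, L, ⟨f⟩⟩⟩ := exists_common_factor hH hF hH hF σ v' w
    have hn := hHF _ _ hS ⟨X, L, ⟨f.trans (boxProdIsoLeft e.symm)⟩⟩
    rw [Set.nontrivial_coe_sort, Set.not_nontrivial_iff] at hn
    exact snd_eq_of_subsingleton hH hF σ v' w hn v

end Automorphisms

/-! ### Strategies from invariants -/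

section Positions

theorem gameDistinguishingNumber_le {X : Type u} {d : ℕ} {G : SimpleGraph X} {first : Player}
    (hd : 1 ≤ d) (h : GentleHasWinningStrategy G d first) : gameDistinguishingNumber G first ≤ d :=
  iInf₂_le d ⟨hd, h⟩

open Function

variable {X : Type u} [DecidableEq X] {d : ℕ}

/-- The partial colouring of the vertices reached after a history of the game; `none` marks the
uncoloured vertices. -/
def position : History X d → X → Option (Fin d)
  | [] => fun _ => none
  | (x, c) :: h => update (position h) x (some c)

theorem position_eq_none_iff (h : History X d) (x : X) :
    position h x = none ↔ Uncolored h x := by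
  induction h with
  | nil => simp [position, Uncolored]
  | cons a h ih =>
    obtain ⟨y, c⟩ := a
    by_cases hxy : x = y
    · subst hxy
      simpa [position, Uncolored] using ⟨c, fun h => absurd rfl h⟩
    · rw [position, update_of_ne hxy, ih]
      simp [Uncolored, hxy]

/-- Since only uncoloured vertices are ever coloured, no move is overwritten in `position`. -/
theorem Play.position_eq_some {s : Strategy X d} {first p : Player} {h : History X d}
    (hp : Play s first p h) {x : X} {c : Fin d} (hx : (x, c) ∈ h) : position h x = some c := by
  have aux : ∀ {h : History X d} {y : X} {b : Fin d}, Uncolored h y →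
      (∀ {x c}, (x, c) ∈ h → position h x = some c) →
      ∀ {x c}, (x, c) ∈ (y, b) :: h → position ((y, b) :: h) x = some c := by
    intro h y b hy ih x c hx
    rcases List.mem_cons.1 hx with hx | hx'
    · simp only [Prod.mk.injEq] at hx
      simp [position, hx.1, hx.2]
    · have hxy : x ≠ y := by
        rintro rfl
        exact hy c hx'
      rw [position, update_of_ne hxy, ih hx']
  induction hp generalizing x c with
  | start => simp at hx
  | gentle_move _ hy _ ih => exact aux hy ih hx
  | rascal_move _ hy ih => exact aux hy ih hx

/-- Gentle can play by keeping up an invariant `P` of the positions in which Rascal is to move,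
if `P` holds (after a move of Gentle, when he starts) at the beginning, every move of Rascal has
an answer that restores `P`, and complete positions satisfying `P` are distinguishing. -/
theorem gentleHasWinningStrategy_of_invariant (G : SimpleGraph X) (first : Player)
    (P : (X → Option (Fin d)) → Prop)
    (hstart : match first with
      | .rascal => P fun _ => none
      | .gentle => ∃ x c, P (update (fun _ => none) x (some c)))
    (hstep : ∀ q, P q → ∀ x c, q x = none → ∃ y b, y ≠ x ∧ q y = none ∧
      P (update (update q x (some c)) y (some b)))
    (hend : ∀ c : X → Fin d, P (fun x => some (c x)) → IsDistinguishing G c) :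
    GentleHasWinningStrategy G d first := by
  classical
  let ok : History X d → X × Fin d → Prop := fun h a => Uncolored h a.1 ∧ P (position (a :: h))
  let s : Strategy X d := fun h => if H : ∃ a, ok h a then some H.choose else none
  have hs₀ : ∀ {h} (H : ∃ a, ok h a), s h = some H.choose := fun H => dif_pos H
  have hs₁ : ∀ {h}, (¬ ∃ a, ok h a) → s h = none := fun H => dif_neg H
  have hs : ∀ {h a}, s h = some a → ok h a := by
    intro h a ha
    by_cases H : ∃ a, ok h a
    · simp only [s, dif_pos H, Option.some.injEq] at ha
      exact ha ▸ H.choose_spec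
    · rw [hs₁ H] at ha
      cases ha
  have hs' : ∀ {h}, (∃ a, ok h a) → ∃ x c, s h = some (x, c) ∧ Uncolored h x := by
    intro h H
    exact ⟨H.choose.1, H.choose.2, hs₀ H, H.choose_spec.1⟩
  have inv : ∀ {p h}, Play s first p h →
      (p = .rascal → P (position h)) ∧ (p = .gentle → ∃ a, ok h a) := by
    intro p h hp
    induction hp with
    | start =>
      cases first with
      | rascal => exact ⟨fun _ => hstart, by simp⟩
      | gentle =>
        obtain ⟨x, c, hx⟩ := hstart
        exact ⟨by simp, fun _ => ⟨(x, c), by simp [Uncolored], hx⟩⟩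
    | gentle_move _ _ h₃ _ => exact ⟨fun _ => (hs h₃).2, by simp⟩
    | @rascal_move h x c _ h₂ ih =>
      refine ⟨by simp, fun _ => ?_⟩
      obtain ⟨y, b, hyx, hy, hP⟩ := hstep _ (ih.1 rfl) x c ((position_eq_none_iff h x).2 h₂)
      refine ⟨(y, b), ?_, hP⟩
      rw [← position_eq_none_iff, position, update_of_ne hyx, hy]
  refine ⟨s, fun h hp _ => hs' ((inv hp).2 rfl), fun p h hp c hc => ?_⟩
  cases p with
  | rascal =>
    apply hend
    convert (inv hp).1 rfl using 1
    exact funext fun x => (hp.position_eq_some (hc x)).symm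
  | gentle =>
    obtain ⟨a, ha, -⟩ := (inv hp).2 rfl
    exact absurd (hc a.1) (ha _)

end Positions

/-! ### Pairings of a finite set -/

section Matchings

/-- A family of involutions of `V` such that any two distinct points are exchanged by one of
them. When the involutions have no fixed points, this is a one-factorization of the complete graph
on `V`, up to repetitions. -/
structure IsPairing {ι V : Type*} (M : ι → V → V) : Prop where
  involutive : ∀ i v, M i (M i v) = v
  exists_eq : ∀ v v', v ≠ v' → ∃ i, M i v = v'

theorem two_mul_injective_zmod {k : ℕ} (hk : Odd k) :
    Function.Injective fun x : ZMod k => 2 * x := by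
  have hu : IsUnit (2 : ZMod k) := by
    have := (ZMod.unitOfCoprime 2 (Nat.coprime_two_left.2 hk)).isUnit
    simpa using this
  exact hu.mul_right_injective

theorem two_mul_surjective_zmod {k : ℕ} (hk : Odd k) :
    Function.Surjective fun x : ZMod k => 2 * x := by
  have : NeZero k := ⟨hk.pos.ne'⟩
  exact Finite.surjective_of_injective (two_mul_injective_zmod hk)

/-- On a set of odd size `n`, identified with `ZMod n`, the reflections `v ↦ 2 * i - v` pair up any
two points and have one fixed point each. -/
theorem exists_isPairing_of_odd {V : Type*} [Fintype V] (hV : Odd (Fintype.card V)) :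
    ∃ M : V → V → V, IsPairing M ∧ ∀ i v, M i v = v ↔ v = i := by
  have : NeZero (Fintype.card V) := ⟨hV.pos.ne'⟩
  let e : V ≃ ZMod (Fintype.card V) := Fintype.equivOfCardEq (ZMod.card _).symm
  refine ⟨fun i v => e.symm (2 * e i - e v), ⟨fun i v => by simp, fun v v' _ => ?_⟩, fun i v => ?_⟩
  · obtain ⟨x, hx⟩ := two_mul_surjective_zmod hV (e v + e v')
    refine ⟨e.symm x, ?_⟩
    simp only at hx
    simp [hx]
  · rw [Equiv.symm_apply_eq, sub_eq_iff_eq_add, ← two_mul, (two_mul_injective_zmod hV).eq_iff,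
      e.injective.eq_iff, eq_comm]

/-- A set of even size `n` is a set of size `n - 1` together with one more point, which the `i`-th
matching joins to the fixed point of the `i`-th reflection of the smaller set. -/
theorem exists_isPairing_of_even {V : Type*} [Fintype V] [Nonempty V]
    (hV : Even (Fintype.card V)) :
    ∃ M : Fin (Fintype.card V - 1) → V → V, IsPairing M ∧ ∀ i v, M i v ≠ v := by
  classical
  have hpos := Fintype.card_pos (α := V)
  have hodd : Odd (Fintype.card V - 1) := Nat.Even.sub_odd hpos hV odd_one
  obtain ⟨N, hN, hfix⟩ := exists_isPairing_of_odd
    (V := Fin (Fintype.card V - 1)) (by rwa [Fintype.card_fin])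
  let e : V ≃ Option (Fin (Fintype.card V - 1)) := Fintype.equivOfCardEq (by simp; omega)
  let M' : Fin (Fintype.card V - 1) → Option (Fin (Fintype.card V - 1)) →
      Option (Fin (Fintype.card V - 1)) := fun i o =>
    o.elim (some i) fun v => if v = i then none else some (N i v)
  have hinv : ∀ i o, M' i (M' i o) = o := by
    rintro i (_ | v)
    · simp [M']
    · by_cases hv : v = i
      · simp [M', hv]
      · have : N i v ≠ i := fun h => hv (by
          have h' := hN.involutive i v
          rwa [h, (hfix i i).2 rfl, eq_comm] at h')
        simp [M', hv, this, hN.involutive]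
  have hne : ∀ i o, M' i o ≠ o := by
    rintro i (_ | v)
    · simp [M']
    · by_cases hv : v = i
      · simp [M', hv]
      · simpa [M', hv] using fun h => hv ((hfix i v).1 h)
  have hex : ∀ o o', o ≠ o' → ∃ i, M' i o = o' := by
    rintro (_ | v) (_ | v') h
    · exact absurd rfl h
    · exact ⟨v', by simp [M']⟩
    · exact ⟨v, by simp [M']⟩
    · have hvv : v ≠ v' := fun h' => h (congrArg some h')
      obtain ⟨i, hi⟩ := hN.exists_eq v v' hvv
      refine ⟨i, ?_⟩
      have : v ≠ i := fun h' => hvv (by rw [← hi, (hfix i v).2 h'])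
      simp [M', this, hi]
  refine ⟨fun i v => e.symm (M' i (e v)), ⟨fun i v => by simp [hinv], fun v v' h => ?_⟩,
    fun i v h => ?_⟩
  · obtain ⟨i, hi⟩ := hex _ _ (e.injective.ne h)
    exact ⟨i, by simp [hi]⟩
  · exact hne i (e v) (e.symm_apply_eq.1 h)

end Matchings

/-! ### Positions good for Gentle -/

section Rows

open Function Finset

variable {V : Type u} {W : Type v} {ι : Type*} {m : ℕ}

/-- The sum of the colours, as elements of the cyclic group `Fin (m + 1)`, of the coloured vertices
in the row `V × {w}`. -/
def rowSum [Fintype V] (q : V × W → Option (Fin (m + 1))) (w : W) : Fin (m + 1) :=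
  ∑ v, (q (v, w)).getD 0

/-- All vertices of the row `V × {w}` are coloured. -/
def RowFull (q : V × W → Option (Fin (m + 1))) (w : W) : Prop :=
  ∀ v, q (v, w) ≠ none

/-- The properties of the positions which Gentle maintains. Among the rows `V × {w}`, those with
`w ∈ O` are called open; the involution `M (e w)` is assigned to such a row. In an open row, the
fixed points are coloured, and the other points come in pairs that are either uncoloured or have
two different colours. The rows which are not open are uncoloured, and different full rows have
different sums of colours. -/
structure Good [Fintype V] (M : ι → V → V) (O : Finset W) (e : W → ι)
    (q : V × W → Option (Fin (m + 1))) : Prop where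
  paired : ∀ w ∈ O, ∀ v, q (v, w) = none → q (M (e w) v, w) = none
  fixed : ∀ w ∈ O, ∀ v, M (e w) v = v → q (v, w) ≠ none
  differ : ∀ w ∈ O, ∀ v, M (e w) v ≠ v → q (v, w) ≠ none → q (M (e w) v, w) ≠ q (v, w)
  closed : ∀ w ∉ O, ∀ v, q (v, w) = none
  sums : ∀ w w', RowFull q w → RowFull q w' → rowSum q w = rowSum q w' → w = w'

theorem good_none [Fintype V] [Nonempty V] (M : ι → V → V) (e : W → ι) :
    Good M ∅ e (fun _ => (none : Option (Fin (m + 1)))) := by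
  constructor <;> simp [RowFull]

variable [DecidableEq V] [DecidableEq W]

theorem rowSum_update [Fintype V] {q : V × W → Option (Fin (m + 1))} {v : V} {w : W}
    (h : q (v, w) = none) (c : Fin (m + 1)) :
    rowSum (update q (v, w) (some c)) w = rowSum q w + c := by
  have h₁ : ∀ x ∈ univ.erase v, ((update q (v, w) (some c)) (x, w)).getD 0 = (q (x, w)).getD 0 := by
    intro x hx
    rw [update_of_ne (by simpa using hx)]
  rw [rowSum, rowSum, ← Finset.sum_erase_add _ _ (mem_univ v), Finset.sum_congr rfl h₁,
    ← Finset.sum_erase_add _ _ (mem_univ v)]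
  simp [h]

theorem rowSum_update_of_ne [Fintype V] (q : V × W → Option (Fin (m + 1))) (v : V) {w w' : W}
    (h : w' ≠ w) (c : Fin (m + 1)) :
    rowSum (update q (v, w) (some c)) w' = rowSum q w' := by
  simp [rowSum, h]

theorem rowFull_update_of_ne (q : V × W → Option (Fin (m + 1))) (v : V) {w w' : W}
    (h : w' ≠ w) (c : Fin (m + 1)) :
    RowFull (update q (v, w) (some c)) w' ↔ RowFull q w' := by
  simp [RowFull, h]

variable [Fintype V] {M : ι → V → V} {O : Finset W} {e : W → ι}
  {q : V × W → Option (Fin (m + 1))}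

/-- When Rascal plays in an open row, Gentle answers at the partner of Rascal's vertex. He has to
avoid Rascal's colour, and at most one colour for each of the other rows, to keep the row sums
different: there are `m + 1` colours and `m` rows, so some colour is left. -/
theorem Good.answer [Fintype W] (hW : Fintype.card W = m) (hM : IsPairing M) (hq : Good M O e q)
    {v : V} {w : W} (hw : w ∈ O) (hv : q (v, w) = none) (c : Fin (m + 1)) :
    ∃ y b, y ≠ (v, w) ∧ q y = none ∧
      Good M O e (update (update q (v, w) (some c)) y (some b)) := by
  have hinv := hM.involutive (e w)
  set f := M (e w) with hf
  have hfv : f v ≠ v := fun h => hq.fixed w hw v h hv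
  have hqf : q (f v, w) = none := hq.paired w hw v hv
  obtain ⟨b, hb⟩ : ∃ b, b ∉ insert c ((univ.erase w).image fun w' =>
      rowSum q w' - rowSum q w - c) := by
    by_contra! h
    have h₁ := (card_le_card (fun b _ => h b : (univ : Finset (Fin (m + 1))) ⊆ _)).trans
      ((card_insert_le _ _).trans (Nat.add_le_add_right card_image_le 1))
    have h₂ := Fintype.card_pos_iff.2 ⟨w⟩
    rw [card_erase_of_mem (mem_univ _), card_univ, card_univ, hW, Fintype.card_fin] at h₁
    omega
  simp only [mem_insert, mem_image, mem_erase, mem_univ, and_true, not_or, not_exists,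
    not_and] at hb
  obtain ⟨hbc, hb⟩ := hb
  refine ⟨(f v, w), b, by simpa using hfv, hqf, ?_⟩
  set q' := update (update q (v, w) (some c)) (f v, w) (some b) with hq'
  have hne : ∀ x w', w' ≠ w → q' (x, w') = q (x, w') := by
    intro x w' h
    simp [hq', h]
  have h₁ : q' (f v, w) = some b := by simp [hq']
  have h₂ : q' (v, w) = some c := by simp [hq', hfv.symm]
  have h₃ : ∀ x, x ≠ v → x ≠ f v → q' (x, w) = q (x, w) := by
    intro x hx hx'
    simp [hq', hx, hx']
  have hsum : rowSum q' w = rowSum q w + c + b := by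
    rw [hq', rowSum_update (by simpa [hfv] using hqf), rowSum_update hv]
  have hsum' : ∀ w', w' ≠ w → rowSum q' w' = rowSum q w' := by
    intro w' h
    rw [hq', rowSum_update_of_ne _ _ h, rowSum_update_of_ne _ _ h]
  have hfull : ∀ w', w' ≠ w → (RowFull q' w' ↔ RowFull q w') := by
    intro w' h
    rw [hq', rowFull_update_of_ne _ _ h, rowFull_update_of_ne _ _ h]
  have hbs : ∀ w', w' ≠ w → rowSum q' w' ≠ rowSum q' w := by
    intro w' h h'
    rw [hsum' w' h, hsum] at h'
    exact hb w' h (by rw [h']; abel)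
  have hf₁ : ∀ x, x ≠ v → f x ≠ f v := fun x hx h => hx (by rw [← hinv x, h, hinv])
  have hf₂ : ∀ x, x ≠ f v → f x ≠ v := fun x hx h => hx (by rw [← h, hinv])
  refine ⟨fun w' hw' x hx => ?_, fun w' hw' x hx => ?_, fun w' hw' x hx hx' => ?_,
    fun w' hw' x => ?_, fun w₁ w₂ h₁ h₂ h => ?_⟩
  · by_cases h : w' = w
    · subst h
      have hxv : x ≠ v := by rintro rfl; simp [h₂] at hx
      have hxf : x ≠ f v := by rintro rfl; simp [h₁] at hx
      rw [h₃ x hxv hxf] at hx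
      rw [h₃ _ (hf₂ x hxf) (hf₁ x hxv)]
      exact hq.paired _ hw' x hx
    · rw [hne _ _ h] at hx ⊢
      exact hq.paired _ hw' x hx
  · by_cases h : w' = w
    · subst h
      by_cases hxv : x = v
      · simp [hxv, h₂]
      by_cases hxf : x = f v
      · simp [hxf, h₁]
      rw [h₃ x hxv hxf]
      exact hq.fixed _ hw' x hx
    · rw [hne _ _ h]
      exact hq.fixed _ hw' x hx
  · by_cases h : w' = w
    · subst h
      rw [← hf]
      by_cases hxv : x = v
      · subst hxv
        simpa [h₁, h₂] using hbc
      by_cases hxf : x = f v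
      · subst hxf
        rw [hinv, h₁, h₂]
        simpa using Ne.symm hbc
      rw [h₃ x hxv hxf] at hx' ⊢
      rw [h₃ _ (hf₂ x hxf) (hf₁ x hxv)]
      exact hq.differ _ hw' x hx hx'
    · rw [hne _ _ h] at hx' ⊢
      rw [hne _ _ h]
      exact hq.differ _ hw' x hx hx'
  · have h : w' ≠ w := fun h => hw' (h ▸ hw)
    rw [hne _ _ h]
    exact hq.closed _ hw' x
  · by_contra hne'
    by_cases hw₁ : w₁ = w
    · subst hw₁
      exact hbs _ (Ne.symm hne') h.symm
    by_cases hw₂ : w₂ = w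
    · subst hw₂
      exact hbs _ hw₁ h
    rw [hsum' _ hw₁, hsum' _ hw₂] at h
    exact hne' (hq.sums _ _ ((hfull _ hw₁).1 h₁) ((hfull _ hw₂).1 h₂) h)

/-- A player may open a row by colouring the unique fixed point of the involution assigned to
it. -/
theorem Good.openRow {M : V → V → V} {e : W → V} [Nontrivial V] (hM : ∀ i v, M i v = v ↔ v = i)
    (hM' : IsPairing M) (hq : Good M O e q) {w : W} (hw : w ∉ O) (v : V) (c : Fin (m + 1)) :
    Good M (insert w O) (update e w v) (update q (v, w) (some c)) := by
  -- The row has a second vertex, so it does not become full and its sum does not matter yet.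
  obtain ⟨v', hv'⟩ := exists_ne v
  have hnf : ¬ RowFull (update q (v, w) (some c)) w := fun h =>
    h v' (by simpa [hv'] using hq.closed w hw v')
  have hmem : ∀ w', w' ≠ w → w' ∈ insert w O → w' ∈ O := fun w' h h' =>
    (mem_insert.1 h').resolve_left h
  have hMv : ∀ x, x ≠ v → M v x ≠ v := fun x hx h => hx (by
    rw [← hM'.involutive v x, h, (hM v v).2 rfl])
  refine ⟨fun w' hw' x hx => ?_, fun w' hw' x hx => ?_, fun w' hw' x hx hx' => ?_,
    fun w' hw' x => ?_, fun w₁ w₂ h₁ h₂ h => ?_⟩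
  · by_cases h : w' = w
    · subst h
      have hxv : x ≠ v := by rintro rfl; simp at hx
      rw [update_self, update_of_ne (by simpa using hMv x hxv)]
      exact hq.closed _ hw _
    · rw [update_of_ne (by simp [h])] at hx ⊢
      rw [update_of_ne h]
      exact hq.paired _ (hmem _ h hw') x hx
  · by_cases h : w' = w
    · subst h
      rw [update_self, hM] at hx
      simp [hx]
    · rw [update_of_ne h] at hx
      rw [update_of_ne (by simp [h])]
      exact hq.fixed _ (hmem _ h hw') x hx
  · by_cases h : w' = w
    · subst h
      rw [update_self, Ne, hM] at hx
      rw [update_of_ne (by simpa using hx)] at hx'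
      exact absurd (hq.closed _ hw _) hx'
    · rw [update_of_ne h] at hx ⊢
      rw [update_of_ne (by simp [h])] at hx' ⊢
      rw [update_of_ne (by simp [h])]
      exact hq.differ _ (hmem _ h hw') x hx hx'
  · rw [mem_insert, not_or] at hw'
    rw [update_of_ne (by simp [hw'.1])]
    exact hq.closed _ hw'.2 x
  · have hw₁ : w₁ ≠ w := fun h => hnf (h ▸ h₁)
    have hw₂ : w₂ ≠ w := fun h => hnf (h ▸ h₂)
    rw [rowFull_update_of_ne _ _ hw₁] at h₁
    rw [rowFull_update_of_ne _ _ hw₂] at h₂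
    rw [rowSum_update_of_ne _ _ hw₁, rowSum_update_of_ne _ _ hw₂] at h
    exact hq.sums _ _ h₁ h₂ h

omit [DecidableEq V] [DecidableEq W] in
/-- In a complete good position, the row sums force a colour-preserving automorphism to map each
row to itself. If it moved a column to another one, it would do so in a row whose involution
exchanges the two columns, but these have different colours in that row. -/
theorem Good.isDistinguishing [Fintype W] {H : SimpleGraph V} {F : SimpleGraph W}
    (hHF : RelativelyPrime H F) (hH : H.Connected) (hF : F.Connected) (hM : IsPairing M)
    {c : V × W → Fin (m + 1)} (hq : Good M univ e (fun x => some (c x))) (he : Surjective e) :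
    IsDistinguishing (H.boxProd F) c := by
  intro σ hσ
  obtain ⟨v₀⟩ := hH.nonempty
  obtain ⟨w₀⟩ := hF.nonempty
  set α : V → V := fun v => (σ (v, w₀)).1
  set β : W → W := fun w => (σ (v₀, w)).2
  have hsplit : ∀ v w, σ (v, w) = (α v, β w) := fun v w => hHF.apply_eq hH hF σ v v₀ w w₀
  have hα : Bijective α := by
    refine Finite.injective_iff_bijective.1 fun v v' h => ?_
    have : σ (v, w₀) = σ (v', w₀) := by rw [hsplit, hsplit, h]
    simpa using this
  have hβ : ∀ w, β w = w := by
    intro w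
    refine hq.sums _ _ (by simp [RowFull]) (by simp [RowFull]) ?_
    simp only [rowSum, Option.getD_some]
    rw [← hα.sum_comp]
    exact Finset.sum_congr rfl fun v _ => by rw [← hsplit, hσ]
  rintro ⟨v, w⟩
  rw [hsplit, hβ]
  by_contra hne
  have hv : v ≠ α v := fun h => hne (by rw [← h])
  obtain ⟨i, hi⟩ := hM.exists_eq v (α v) hv
  obtain ⟨w', rfl⟩ := he i
  refine hq.differ w' (mem_univ _) v (by rw [hi]; exact hv.symm) (by simp) ?_
  rw [hi, ← hσ (v, w'), hsplit, hβ]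

end Rows

/-! ### Gentle's strategies -/

section Strategies

open Function Finset

variable {V : Type u} {W : Type v} [Fintype V] [Fintype W] {m : ℕ} {H : SimpleGraph V}
  {F : SimpleGraph W}

/-- When `n` is even, every row is paired by a perfect matching from the start; as `m ≥ n - 1`,
each of the `n - 1` matchings of a one-factorization can be assigned to some row. -/
theorem gentleHasWinningStrategy_of_even (hHF : RelativelyPrime H F) (hH : H.Connected)
    (hF : F.Connected) (hW : Fintype.card W = m) (hV : Even (Fintype.card V))
    (hVm : Fintype.card V - 1 ≤ m) [Nontrivial V] :
    GentleHasWinningStrategy (H.boxProd F) (m + 1) .rascal := by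
  classical
  obtain ⟨M, hM, hfix⟩ := exists_isPairing_of_even hV
  have hpos := Fintype.one_lt_card (α := V)
  have : Nonempty (Fin (Fintype.card V - 1)) := ⟨⟨0, by omega⟩⟩
  obtain ⟨g⟩ : Nonempty (Fin (Fintype.card V - 1) ↪ W) :=
    Function.Embedding.nonempty_of_card_le (by simpa [hW] using hVm)
  have he : Surjective (invFun g) := invFun_surjective g.injective
  refine gentleHasWinningStrategy_of_invariant _ _ (Good M univ (invFun g)) ?_ ?_
    fun c hc => hc.isDistinguishing hHF hH hF hM he
  · constructor <;> simp [RowFull, hfix]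
  · rintro q hq ⟨v, w⟩ c hv
    exact hq.answer hW hM (mem_univ w) hv c

/-- The invariant of Gentle's strategy when `n` is odd: the number of rows that are not open is
even, and once some row is open, the involutions not yet in use are no more than half of those
rows. -/
def OddInvariant (M : V → V → V) (q : V × W → Option (Fin (m + 1))) : Prop :=
  ∃ (O : Finset W) (e : W → V), Good M O e q ∧ ∃ k, #O + 2 * k = Fintype.card W ∧
    (O = ∅ ∨ ∃ I : Finset V, (∀ i ∈ I, ∃ w ∈ O, e w = i) ∧ Fintype.card V ≤ #I + k)

variable {M : V → V → V}

theorem OddInvariant.exists_good_univ [Nonempty V] [Nonempty W] {c : V × W → Fin (m + 1)}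
    (h : OddInvariant M (fun x => some (c x))) :
    ∃ e : W → V, Surjective e ∧ Good M univ e (fun x => some (c x)) := by
  obtain ⟨O, e, hq, k, hk, hO⟩ := h
  have hO' : O = univ := by
    ext w
    simp only [mem_univ, iff_true]
    by_contra hw
    simpa using hq.closed w hw (Classical.arbitrary V)
  subst hO'
  rcases hO with hO | ⟨I, hI, hcard⟩
  · exact absurd hO univ_nonempty.ne_empty
  · have hk₀ : k = 0 := by rw [card_univ] at hk; omega
    have hIu : I = univ := by
      rw [← card_eq_iff_eq_univ]
      exact le_antisymm (card_le_univ I) (by omega)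
    subst hIu
    exact ⟨e, fun i => (hI i (mem_univ i)).imp fun w hw => hw.2, hq⟩

/-- If Rascal opens a row, Gentle opens another one with an involution not yet in use. The
first time this happens, Rascal's own involution is new as well. -/
theorem OddInvariant.answer [DecidableEq V] [DecidableEq W] [Nontrivial V]
    (hW : Fintype.card W = m) (hM : IsPairing M)
    (hfix : ∀ i v, M i v = v ↔ v = i) (hVm : 2 * Fintype.card V - 2 ≤ m)
    {q : V × W → Option (Fin (m + 1))} (h : OddInvariant M q) {x : V × W} (hx : q x = none)
    (c : Fin (m + 1)) : ∃ y b, y ≠ x ∧ q y = none ∧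
      OddInvariant M (update (update q x (some c)) y (some b)) := by
  obtain ⟨O, e, hq, k, hk, hO⟩ := h
  obtain ⟨v, w⟩ := x
  by_cases hw : w ∈ O
  · obtain ⟨y, b, hy, hy', hq'⟩ := hq.answer hW hM hw hx c
    exact ⟨y, b, hy, hy', O, e, hq', k, hk, hO⟩
  obtain ⟨w', hw'⟩ : ∃ w', w' ∉ insert w O := by
    by_contra! hall
    have := card_insert_of_notMem hw
    rw [(eq_univ_iff_forall.2 hall), card_univ] at this
    omega
  have hww : w' ≠ w := fun h => hw' (h ▸ mem_insert_self _ _)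
  have hwO : w' ∉ O := fun h => hw' (mem_insert_of_mem h)
  obtain ⟨k, rfl⟩ : ∃ l, k = l + 1 := by
    refine Nat.exists_eq_succ_of_ne_zero ?_
    rintro rfl
    have hO' : O = univ := (card_eq_iff_eq_univ O).1 (by omega)
    exact hw (hO' ▸ mem_univ w)
  have hcard : #(insert w' (insert w O)) + 2 * k = Fintype.card W := by
    rw [card_insert_of_notMem hw', card_insert_of_notMem hw]
    omega
  -- `y` is the point at which Gentle opens the row `w'`, and `I` consists of involutions that are
  -- then in use.
  have key : ∃ (y : V) (I : Finset V), (∀ i ∈ I, i = y ∨ i = v ∨ ∃ w ∈ O, e w = i) ∧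
      Fintype.card V ≤ #I + k := by
    rcases hO with rfl | ⟨I, hI, hcardI⟩
    · obtain ⟨y, hy⟩ := exists_ne v
      refine ⟨y, {y, v}, by simp, ?_⟩
      have := Fintype.one_lt_card (α := V)
      rw [card_pair hy]
      simp only [card_empty] at hk
      omega
    · by_cases hall : ∃ y, y ∉ I
      · obtain ⟨y, hy⟩ := hall
        refine ⟨y, insert y I, fun i hi => ?_, by rw [card_insert_of_notMem hy]; omega⟩
        exact (mem_insert.1 hi).imp_right fun h => .inr (hI i h)
      · push Not at hall
        refine ⟨v, I, fun i hi => .inr (.inr (hI i hi)), ?_⟩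
        rw [eq_univ_iff_forall.2 hall, card_univ]
        omega
  obtain ⟨y, I, hI, hcardI⟩ := key
  refine ⟨(y, w'), 0, by simp [hww], hq.closed w' hwO y, _, _,
    (hq.openRow hfix hM hw v c).openRow hfix hM hw' y 0, k, hcard, .inr ⟨I, fun i hi => ?_, hcardI⟩⟩
  rcases hI i hi with rfl | rfl | ⟨z, hz, rfl⟩
  · exact ⟨w', by simp, by simp⟩
  · exact ⟨w, by simp, by simp [hww.symm]⟩
  · have hzw : z ≠ w := fun h => hw (h ▸ hz)
    have hzw' : z ≠ w' := fun h => hwO (h ▸ hz)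
    exact ⟨z, by simp [hz], by simp [hzw, hzw']⟩

theorem gentleHasWinningStrategy_of_odd (hHF : RelativelyPrime H F) (hH : H.Connected)
    (hF : F.Connected) (hW : Fintype.card W = m) (hV : Odd (Fintype.card V)) [Nontrivial V]
    (first : Player) (hm : match first with
      | .rascal => Even m ∧ 2 * Fintype.card V - 2 ≤ m
      | .gentle => Odd m ∧ 2 * Fintype.card V - 1 ≤ m) :
    GentleHasWinningStrategy (H.boxProd F) (m + 1) first := by
  classical
  obtain ⟨M, hM, hfix⟩ := exists_isPairing_of_odd hV
  have hVm : 2 * Fintype.card V - 2 ≤ m := by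
    cases first with
    | rascal => exact hm.2
    | gentle => have := hm.2; omega
  have := hF.nonempty
  obtain ⟨v₀⟩ := hH.nonempty
  obtain ⟨w₀⟩ := hF.nonempty
  refine gentleHasWinningStrategy_of_invariant _ _ (OddInvariant M) ?_
    (fun q hq x c hx => hq.answer hW hM hfix hVm hx c) fun c hc => ?_
  · have hnone := good_none (m := m) M (fun _ : W => v₀)
    cases first with
    | rascal =>
      obtain ⟨k, hk⟩ := hm.1
      exact ⟨∅, _, hnone, k, by simp; omega, .inl rfl⟩
    | gentle =>
      obtain ⟨⟨k, hk⟩, hm⟩ := hm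
      refine ⟨(v₀, w₀), 0, _, _, hnone.openRow hfix hM (notMem_empty w₀) v₀ 0, k,
        by simp; omega, .inr ⟨{v₀}, by simp, ?_⟩⟩
      rw [card_singleton]
      omega
  · obtain ⟨e, he, hq⟩ := hc.exists_good_univ
    exact hq.isDistinguishing hHF hH hF hM he

end Strategies

end DistinguishingGame

theorem theorem1p4 {V : Type*} {W : Type*} [Fintype V] [Fintype W] [Nontrivial V] [Nontrivial W]
    (H : SimpleGraph V) (F : SimpleGraph W) (hH : H.Connected) (hF : F.Connected)
    (hHF : DistinguishingGame.RelativelyPrime H F)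
    (n m : ℕ) (hn : Fintype.card V = n) (hm : Fintype.card W = m) :
    (Even n → n - 1 ≤ m → DistinguishingGame.DR (H.boxProd F) ≤ (m : ℕ∞) + 1) ∧
    (Odd n → Even m → 2 * n - 2 ≤ m → DistinguishingGame.DR (H.boxProd F) ≤ (m : ℕ∞) + 1) ∧
    (Odd n → Odd m → 2 * n - 1 ≤ m → DistinguishingGame.DG (H.boxProd F) ≤ (m : ℕ∞) + 1) := by
  subst hn
  have hd : 1 ≤ m + 1 := Nat.le_add_left 1 m
  refine ⟨fun h h' => ?_, fun h h' h'' => ?_, fun h h' h'' => ?_⟩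
  · exact_mod_cast DistinguishingGame.gameDistinguishingNumber_le hd
      (DistinguishingGame.gentleHasWinningStrategy_of_even hHF hH hF hm h h')
  · exact_mod_cast DistinguishingGame.gameDistinguishingNumber_le hd
      (DistinguishingGame.gentleHasWinningStrategy_of_odd hHF hH hF hm h .rascal ⟨h', h''⟩)
  · exact_mod_cast DistinguishingGame.gameDistinguishingNumber_le hd
      (DistinguishingGame.gentleHasWinningStrategy_of_odd hHF hH hF hm h .gentle ⟨h', h''⟩)
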